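/- **Theorem (Schmidt number iteration).** Let $\mathcal M_d$ be the complex $d\times d$ matrices and $n\ge 2$. A linear map $T:\mathcal M_d\to\mathcal M_d$ is *completely positive* if $\mathrm{id}_m\otimes T$ maps positive semidefinite matrices to positive semidefinite matrices for every $m\in\mathbb N$. A matrix in $\mathcal M_m\otimes\mathcal M_d$ is *separable* if it is a finite sum of matrices $A\otimes B$ with $A\in\mathcal M_m$, $B\in\mathcal M_d$ positive semidefinite. $T$ is *$n$-entanglement breaking* if $(\mathrm{id}_n\otimes T)(X)$ is separable for every positive semidefinite $X\in\mathcal M_n\otimes\mathcal M_d$, and *entanglement breaking* if $(\mathrm{id}_d\otimes T)(X)$ is separable for every positive semidefinite $X\in\mathcal M_d\otimes\mathcal M_d$. The *Schmidt rank* of $\psi\in\mathbb C^d\otimes\mathbb C^d$ is the rank of $(\mathrm{id}_d\otimes\mathrm{tr})(|\psi\rangle\langle\psi|)$, and the *Schmidt number* $\mathrm{SN}(X)$ of a positive semidefinite $X\in\mathcal M_d\otimes\mathcal M_d$ is the least integer $k\ge1$ such that $X=\sum_{i=1}^l|\psi_i\rangle\langle\psi_i|$ for some $l$ and vectors $\psi_i$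 of Schmidt rank at most $k$. 1. If $T:\mathcal M_d\to\mathcal M_d$ is completely positive and $n$-entanglement breaking, then for every positive semidefinite $X\in\mathcal M_d\otimes\mathcal M_d$ $$\mathrm{SN}\big((\mathrm{id}_d\otimes T)(X)\big)\le\max\big(\mathrm{SN}(X)-(n-1),\,1\big).$$ 2. Let $N=\lceil\frac{d-1}{n-1}\rceil$. If $T_1,\dots,T_N:\mathcal M_d\to\mathcal M_d$ are completely positive and each is $n$-entanglement breaking, then $T_N\circ\cdots\circ T_1$ is entanglement breaking (for $N=0$ the composition is the identity map). -/

import Mathlib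

open scoped Kronecker ComplexOrder

namespace SchmidtIteration

/-- `M_d`, the complex `d × d` matrices. -/
abbrev Mat (d : ℕ) : Type := Matrix (Fin d) (Fin d) ℂ

/-- `M_m ⊗ M_d`, realised as matrices over the product index set; the elementary tensor of
`A` and `B` is the Kronecker product `A ⊗ₖ B`. -/
abbrev BiMat (m d : ℕ) : Type := Matrix (Fin m × Fin d) (Fin m × Fin d) ℂ

/-- `id_m ⊗ T : M_m ⊗ M_{d₁} → M_m ⊗ M_{d₂}`, i.e. `T` applied to every block
`X_{ij} ∈ M_{d₁}` of `X = ∑ᵢⱼ |i⟩⟨j| ⊗ X_{ij}`. -/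
def idTensor (m : ℕ) {d₁ d₂ : ℕ} (T : Mat d₁ →ₗ[ℂ] Mat d₂) :
    BiMat m d₁ →ₗ[ℂ] BiMat m d₂ where
  toFun X := Matrix.of fun p q =>
    T (Matrix.of fun a b => X (p.1, a) (q.1, b)) p.2 q.2
  map_add' X Y := by
    ext p q
    exact congrFun (congrFun (T.map_add (Matrix.of fun a b => X (p.1, a) (q.1, b))
      (Matrix.of fun a b => Y (p.1, a) (q.1, b))) p.2) q.2
  map_smul' c X := by
    ext p q
    exact congrFun (congrFun (T.map_smul c
      (Matrix.of fun a b => X (p.1, a) (q.1, b))) p.2) q.2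

/-- `idTensor` acts on elementary tensors as it should; this determines it by linearity. -/
theorem idTensor_kronecker {m d₁ d₂ : ℕ} (T : Mat d₁ →ₗ[ℂ] Mat d₂) (A : Mat m) (B : Mat d₁) :
    idTensor m T (A ⊗ₖ B) = A ⊗ₖ T B := by
  ext p q
  exact congrFun (congrFun (T.map_smul (A p.1 q.1) B) p.2) q.2

/-- `T` is completely positive: `id_m ⊗ T` is a positive map for all `m`. -/
def IsCompletelyPositive {d₁ d₂ : ℕ} (T : Mat d₁ →ₗ[ℂ] Mat d₂) : Prop :=
  ∀ (m : ℕ) (X : BiMat m d₁), X.PosSemidef → (idTensor m T X).PosSemidef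

/-- `X` is separable: it lies in the convex cone generated by the products `A ⊗ B` of positive
matrices (nonnegative coefficients are absorbed into `A`). -/
def IsSeparable {m d : ℕ} (X : BiMat m d) : Prop :=
  ∃ (l : ℕ) (A : Fin l → Mat m) (B : Fin l → Mat d),
    (∀ i, (A i).PosSemidef) ∧ (∀ i, (B i).PosSemidef) ∧ X = ∑ i, A i ⊗ₖ B i

/-- `T` is `n`-entanglement breaking: `(id_n ⊗ T)(X)` is separable for every positive `X`. -/
def IsNEntanglementBreaking (n : ℕ) {d₁ d₂ : ℕ} (T : Mat d₁ →ₗ[ℂ] Mat d₂) : Prop :=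
  ∀ X : BiMat n d₁, X.PosSemidef → IsSeparable (idTensor n T X)

/-- A linear map `T : M_d → M_d` is entanglement breaking: `(id_d ⊗ T)(X)` is separable for
every positive `X ∈ M_d ⊗ M_d`. -/
def IsEntanglementBreaking {d : ℕ} (T : Mat d →ₗ[ℂ] Mat d) : Prop :=
  ∀ X : BiMat d d, X.PosSemidef → IsSeparable (idTensor d T X)

/-- `|ψ⟩⟨ψ|` for `ψ ∈ ℂ^m ⊗ ℂ^d`. -/
def proj {m d : ℕ} (ψ : Fin m × Fin d → ℂ) : BiMat m d :=
  Matrix.vecMulVec ψ (star ψ)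

/-- The partial trace `id_m ⊗ tr : M_m ⊗ M_d → M_m`. -/
def partialTrace {m d : ℕ} (X : BiMat m d) : Mat m :=
  Matrix.of fun i j => ∑ a, X (i, a) (j, a)

/-- The Schmidt rank of `ψ ∈ ℂ^m ⊗ ℂ^d`. -/
noncomputable def schmidtRank {m d : ℕ} (ψ : Fin m × Fin d → ℂ) : ℕ :=
  (partialTrace (proj ψ)).rank

/-- The Schmidt number of a positive matrix `X ∈ M_m ⊗ M_d`: the least integer `k ≥ 1` such
that `X = ∑ᵢ |ψᵢ⟩⟨ψᵢ|` (a finite sum) with all Schmidt ranks at most `k`. (Every positive `X` has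
such a decomposition, so the infimum is attained.) -/
noncomputable def schmidtNumber {m d : ℕ} (X : BiMat m d) : ℕ :=
  sInf {k : ℕ | 1 ≤ k ∧ ∃ (l : ℕ) (ψ : Fin l → Fin m × Fin d → ℂ),
    (∀ i, schmidtRank (ψ i) ≤ k) ∧ X = ∑ i, proj (ψ i)}

/-- `compose T N = T_N ∘ ⋯ ∘ T_1` (the identity for `N = 0`). -/
def compose {d : ℕ} (T : ℕ → (Mat d →ₗ[ℂ] Mat d)) : ℕ → (Mat d →ₗ[ℂ] Mat d)
  | 0 => LinearMap.id
  | N + 1 => T (N + 1) ∘ₗ compose T N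

end SchmidtIteration

/-!
Decompositions of a matrix on `ℂ^m ⊗ ℂ^d` into projectors `|ψ⟩⟨ψ|` with `ψ` of Schmidt rank at most
`k` are the central object (`HasSchmidtDecomposition`); a vector `ψ` is identified with its
coefficient matrix, so that its Schmidt rank becomes a matrix rank (`schmidtRank_eq_rank`).

Let `T` be completely positive and `n`-entanglement breaking, and let `Z ≥ 0` on
`ℂ^(n+m) ⊗ ℂ^d`. Then `Y = (id ⊗ T)(Z) ≥ 0`, and its compression to `ℂ^n ⊗ ℂ^d` is
`(id_n ⊗ T)` of the compression of `Z`, hence separable: it equals `A Aᴴ` with product vectors as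
the columns of `A`. A block Cholesky factorization (`exists_fromBlocks_factorization`) extends `A` to
a factorization `Y = G Gᴴ` whose columns restrict to a column of `A` or to zero on `ℂ^n ⊗ ℂ^d`. The
coefficient matrix of such a column has rank at most one on its first `n` rows, so it has rank at
most `m + 1` (`hasSchmidtDecomposition_of_compression_isSeparable`).

A vector of Schmidt rank at most `n + m` is the image under some `U ⊗ 1` of a vector of
`ℂ^(n+m) ⊗ ℂ^d` (`exists_rank_factorization`). The map `X ↦ (U ⊗ 1) X (U ⊗ 1)ᴴ` commutes with
`id ⊗ T` and does not increase Schmidt ranks, so the previous paragraph bounds the Schmidt number of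
`(id ⊗ T)(X)` by `m + 1`, where `m = SN(X) - n` (truncated).

The Schmidt number on `ℂ^d ⊗ ℂ^d` is at most `d`, and `⌈(d - 1) / (n - 1)⌉` applications bring it
down to `1`, which means separability.
-/

namespace SchmidtIteration

open Matrix

/-! ### Matrix factorizations -/

theorem exists_eq_mul_of_range_le {p q r : Type*} [Fintype q] [Fintype r]
    (A : Matrix p q ℂ) (B : Matrix p r ℂ)
    (h : LinearMap.range B.mulVecLin ≤ LinearMap.range A.mulVecLin) :
    ∃ Z : Matrix q r ℂ, B = A * Z := by
  classical
  have hcol : ∀ j, ∃ z : q → ℂ, A *ᵥ z = B.col j := fun j => by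
    obtain ⟨z, hz⟩ := h ⟨Pi.single j 1, rfl⟩
    exact ⟨z, by simpa using hz⟩
  choose z hz using hcol
  refine ⟨Matrix.of fun i j => z j i, ?_⟩
  ext i j
  exact (congrFun (hz j) i).symm

/-- The inclusion of the range of `B` in that of `B * Bᴴ`, as a factorization. -/
theorem exists_eq_mul_conjTranspose_mul {p q : Type*} [Fintype p] [Fintype q]
    (B : Matrix p q ℂ) : ∃ Z : Matrix p q ℂ, B = B * Bᴴ * Z := by
  refine exists_eq_mul_of_range_le _ _ (le_of_eq ?_)
  symm
  refine Submodule.eq_of_le_of_finrank_eq ?_ (rank_self_mul_conjTranspose B)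
  rintro _ ⟨x, rfl⟩
  exact ⟨Bᴴ *ᵥ x, by simp⟩

/-- A matrix of rank at most `k` factors through `ℂ^k`. -/
theorem exists_rank_factorization {p q : Type*} [Fintype p] [Fintype q] {k : ℕ}
    (A : Matrix p q ℂ) (h : A.rank ≤ k) :
    ∃ (U : Matrix p (Fin k) ℂ) (V : Matrix (Fin k) q ℂ), A = U * V := by
  classical
  let b := Module.finBasis ℂ (LinearMap.range A.mulVecLin)
  -- The columns of `U` are a basis of the range of `A`, padded with zeros.
  let v : Fin k → p → ℂ := fun i =>
    if hi : (i : ℕ) < Module.finrank ℂ (LinearMap.range A.mulVecLin) then (b ⟨i, hi⟩ : p → ℂ) else 0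
  refine ⟨Matrix.of fun i j => v j i, exists_eq_mul_of_range_le _ _ ?_⟩
  rw [range_mulVecLin (Matrix.of fun i j => v j i)]
  have hb := congrArg (Submodule.map (LinearMap.range A.mulVecLin).subtype) b.span_eq
  rw [Submodule.map_span, Submodule.map_top, Submodule.range_subtype] at hb
  rw [← hb]
  refine Submodule.span_mono ?_
  rintro _ ⟨_, ⟨i, rfl⟩, rfl⟩
  refine ⟨⟨i, lt_of_lt_of_le i.2 h⟩, ?_⟩
  ext a
  simp [v, Matrix.col]

theorem rank_add_le {p q : Type*} [Fintype p] [Fintype q] (A B : Matrix p q ℂ) :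
    (A + B).rank ≤ A.rank + B.rank := by
  refine le_trans (Submodule.finrank_mono ?_)
    (Submodule.finrank_add_le_finrank_add_finrank (LinearMap.range A.mulVecLin)
      (LinearMap.range B.mulVecLin))
  rintro _ ⟨x, rfl⟩
  rw [mulVecLin_add]
  exact Submodule.add_mem_sup ⟨x, rfl⟩ ⟨x, rfl⟩

theorem exists_eq_mul_conjTranspose_of_posSemidef {p : Type*} [Fintype p] {M : Matrix p p ℂ}
    (hM : M.PosSemidef) : ∃ (l : ℕ) (B : Matrix p (Fin l) ℂ), M = B * Bᴴ := by
  obtain ⟨l, v, rfl⟩ := posSemidef_iff_eq_sum_vecMulVec.mp hM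
  refine ⟨l, Matrix.of fun i j => v j i, ?_⟩
  ext i j
  simp [Matrix.sum_apply, Matrix.mul_apply, vecMulVec_apply]

/-- Block Cholesky factorization: any factorization `A * Aᴴ` of a diagonal block of a positive
semidefinite matrix extends to a lower triangular factorization of the whole matrix. -/
theorem exists_fromBlocks_factorization {α β γ : Type*} [Fintype α] [Fintype β] [Fintype γ]
    {M : Matrix (α ⊕ β) (α ⊕ β) ℂ} (hM : M.PosSemidef) (A : Matrix α γ ℂ)
    (hA : M.toBlocks₁₁ = A * Aᴴ) :
    ∃ (l : ℕ) (X : Matrix β γ ℂ) (C : Matrix β (Fin l) ℂ),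
      M = fromBlocks A 0 X C * (fromBlocks A 0 X C)ᴴ := by
  classical
  obtain ⟨r, B, hB⟩ := exists_eq_mul_conjTranspose_of_posSemidef hM
  obtain ⟨B₁, B₂, rfl⟩ : ∃ B₁ B₂, B = fromRows B₁ B₂ := ⟨_, _, (fromRows_toRows B).symm⟩
  have hblocks : M = fromBlocks (B₁ * B₁ᴴ) (B₁ * B₂ᴴ) (B₂ * B₁ᴴ) (B₂ * B₂ᴴ) := by
    rw [hB, conjTranspose_fromRows_eq_fromCols_conjTranspose, fromRows_mul_fromCols]
  have hP : B₁ * B₁ᴴ = A * Aᴴ := by rw [← hA, hblocks, toBlocks_fromBlocks₁₁]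
  -- The range of the off-diagonal block lies in that of the positive block `B₁ * B₁ᴴ`.
  obtain ⟨Z, hQ⟩ : ∃ Z : Matrix α β ℂ, B₁ * B₂ᴴ = A * Aᴴ * Z := by
    obtain ⟨W, hW⟩ := exists_eq_mul_conjTranspose_mul B₁
    exact ⟨W * B₂ᴴ, by rw [← hP, ← Matrix.mul_assoc, ← hW]⟩
  have hQ' : B₂ * B₁ᴴ = Zᴴ * (A * Aᴴ) := by
    have := congrArg conjTranspose hQ
    simpa [Matrix.mul_assoc] using this
  -- The Schur complement is the Gram matrix of the rows of `B₂ - Zᴴ * B₁`.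
  have hS : (B₂ * B₂ᴴ - Zᴴ * (A * Aᴴ) * Z).PosSemidef := by
    have h : B₂ * B₂ᴴ - Zᴴ * (A * Aᴴ) * Z = (B₂ - Zᴴ * B₁) * (B₂ - Zᴴ * B₁)ᴴ := by
      have h1 : Zᴴ * B₁ * B₂ᴴ = Zᴴ * (A * Aᴴ) * Z := by
        rw [Matrix.mul_assoc, hQ, ← Matrix.mul_assoc]
      have h2 : B₂ * (B₁ᴴ * Z) = Zᴴ * (A * Aᴴ) * Z := by
        rw [← Matrix.mul_assoc, hQ']
      have h3 : Zᴴ * B₁ * (B₁ᴴ * Z) = Zᴴ * (A * Aᴴ) * Z := by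
        rw [← hP]; simp only [Matrix.mul_assoc]
      rw [conjTranspose_sub, conjTranspose_mul, conjTranspose_conjTranspose, Matrix.sub_mul,
        Matrix.mul_sub, Matrix.mul_sub, h1, h2, h3]
      abel
    rw [h]
    exact posSemidef_self_mul_conjTranspose _
  obtain ⟨l, C, hC⟩ := exists_eq_mul_conjTranspose_of_posSemidef hS
  refine ⟨l, Zᴴ * A, C, ?_⟩
  rw [hblocks, fromBlocks_conjTranspose, fromBlocks_multiply, ← hC, hP, hQ, hQ']
  congr 1 <;> simp [Matrix.mul_assoc]

/-! ### Schmidt rank as matrix rank -/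

/-- The coefficient matrix of a vector of `ℂ^m ⊗ ℂ^d`. -/
def coeffMatrix {m d : ℕ} (ψ : Fin m × Fin d → ℂ) : Matrix (Fin m) (Fin d) ℂ :=
  Matrix.of fun i a => ψ (i, a)

theorem schmidtRank_eq_rank {m d : ℕ} (ψ : Fin m × Fin d → ℂ) :
    schmidtRank ψ = (coeffMatrix ψ).rank := by
  rw [← rank_self_mul_conjTranspose, schmidtRank]
  congr 1

/-- `(U ⊗ 1) X (U ⊗ 1)ᴴ`, for `X` on `ℂ^m ⊗ ℂ^d`. -/
def leftConj {m m' : ℕ} (d : ℕ) (U : Matrix (Fin m') (Fin m) ℂ) (X : BiMat m d) : BiMat m' d :=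
  (U ⊗ₖ (1 : Mat d)) * X * (U ⊗ₖ (1 : Mat d))ᴴ

theorem leftConj_apply {m m' d : ℕ} (U : Matrix (Fin m') (Fin m) ℂ) (X : BiMat m d)
    (p q : Fin m' × Fin d) :
    leftConj d U X p q = ∑ s, ∑ t, (U p.1 s * star (U q.1 t)) * X (s, p.2) (t, q.2) := by
  simp only [leftConj, Matrix.mul_apply, Fintype.sum_prod_type, conjTranspose_apply,
    kroneckerMap_apply, Matrix.one_apply, mul_ite, mul_one, mul_zero, ite_mul, zero_mul,
    apply_ite star, star_zero, Finset.sum_ite_eq, Finset.mem_univ, if_true, Finset.sum_mul]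
  rw [Finset.sum_comm]
  exact Finset.sum_congr rfl fun s _ => Finset.sum_congr rfl fun t _ => by ring

theorem idTensor_leftConj {m m' d₁ d₂ : ℕ} (T : Mat d₁ →ₗ[ℂ] Mat d₂)
    (U : Matrix (Fin m') (Fin m) ℂ) (X : BiMat m d₁) :
    idTensor m' T (leftConj d₁ U X) = leftConj d₂ U (idTensor m T X) := by
  ext p q
  have h : (Matrix.of fun a b => leftConj d₁ U X (p.1, a) (q.1, b)) =
      ∑ s, ∑ t, (U p.1 s * star (U q.1 t)) • Matrix.of fun a b => X (s, a) (t, b) := by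
    ext a b
    simp [leftConj_apply, Matrix.sum_apply]
  have h' : idTensor m' T (leftConj d₁ U X) p q =
      T (Matrix.of fun a b => leftConj d₁ U X (p.1, a) (q.1, b)) p.2 q.2 := rfl
  rw [h', h, leftConj_apply]
  simp only [map_sum, map_smul, Matrix.sum_apply, Matrix.smul_apply, smul_eq_mul]
  rfl

theorem leftConj_proj {m m' d : ℕ} (U : Matrix (Fin m') (Fin m) ℂ) (ψ : Fin m × Fin d → ℂ) :
    leftConj d U (proj ψ) = proj fun p => (U * coeffMatrix ψ) p.1 p.2 := by
  ext p q
  simp only [leftConj_apply, proj, vecMulVec_apply, Matrix.mul_apply, Pi.star_apply, star_sum,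
    star_mul', Finset.sum_mul_sum, coeffMatrix, Matrix.of_apply]
  exact Finset.sum_congr rfl fun s _ => Finset.sum_congr rfl fun t _ => by ring

/-! ### Decompositions into vectors of bounded Schmidt rank -/

/-- `X` is a finite sum of projectors `|ψ⟩⟨ψ|` with `ψ` of Schmidt rank at most `k`. -/
def HasSchmidtDecomposition {m d : ℕ} (k : ℕ) (X : BiMat m d) : Prop :=
  ∃ (l : ℕ) (ψ : Fin l → Fin m × Fin d → ℂ), (∀ i, schmidtRank (ψ i) ≤ k) ∧ X = ∑ i, proj (ψ i)

theorem HasSchmidtDecomposition.of_fintype {m d k : ℕ} {X : BiMat m d} {ι : Type*} [Fintype ι]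
    (ψ : ι → Fin m × Fin d → ℂ) (hψ : ∀ i, schmidtRank (ψ i) ≤ k) (hX : X = ∑ i, proj (ψ i)) :
    HasSchmidtDecomposition k X := by
  refine ⟨Fintype.card ι, fun i => ψ ((Fintype.equivFin ι).symm i), fun i => hψ _, ?_⟩
  rw [hX]
  exact ((Fintype.equivFin ι).symm.sum_comp fun i => proj (ψ i)).symm

theorem HasSchmidtDecomposition.sum {m d k : ℕ} {ι : Type*} [Fintype ι] {X : ι → BiMat m d}
    (h : ∀ i, HasSchmidtDecomposition k (X i)) : HasSchmidtDecomposition k (∑ i, X i) := by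
  choose l ψ hψ hX using h
  refine .of_fintype (ι := Σ i, Fin (l i)) (fun j => ψ j.1 j.2) (fun j => hψ _ _) ?_
  rw [Fintype.sum_sigma]
  exact Finset.sum_congr rfl fun i _ => hX i

theorem HasSchmidtDecomposition.leftConj {m m' d k : ℕ} {X : BiMat m d}
    (h : HasSchmidtDecomposition k X) (U : Matrix (Fin m') (Fin m) ℂ) :
    HasSchmidtDecomposition k (leftConj d U X) := by
  obtain ⟨l, ψ, hψ, rfl⟩ := h
  refine ⟨l, fun i p => (U * coeffMatrix (ψ i)) p.1 p.2, fun i => ?_, ?_⟩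
  · rw [schmidtRank_eq_rank]
    refine (rank_mul_le_right U (coeffMatrix (ψ i))).trans ?_
    rw [← schmidtRank_eq_rank]
    exact hψ i
  · simp only [← leftConj_proj]
    simp only [SchmidtIteration.leftConj, Matrix.mul_sum, Matrix.sum_mul]

theorem HasSchmidtDecomposition.mono {m d k k' : ℕ} {X : BiMat m d}
    (h : HasSchmidtDecomposition k X) (hk : k ≤ k') : HasSchmidtDecomposition k' X := by
  obtain ⟨l, ψ, hψ, hX⟩ := h
  exact ⟨l, ψ, fun i => (hψ i).trans hk, hX⟩

theorem hasSchmidtDecomposition_of_posSemidef {m d : ℕ} {X : BiMat m d} (hX : X.PosSemidef) :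
    HasSchmidtDecomposition m X := by
  obtain ⟨l, ψ, h⟩ := posSemidef_iff_eq_sum_vecMulVec.mp hX
  exact ⟨l, ψ, fun i => rank_le_height _, h⟩

theorem HasSchmidtDecomposition.schmidtNumber_le {m d k : ℕ} {X : BiMat m d}
    (h : HasSchmidtDecomposition k X) (hk : 1 ≤ k) : schmidtNumber X ≤ k :=
  Nat.sInf_le ⟨hk, h⟩

/-- The infimum defining the Schmidt number is attained. -/
theorem hasSchmidtDecomposition_schmidtNumber {m d : ℕ} {X : BiMat m d} (hX : X.PosSemidef) :
    HasSchmidtDecomposition (schmidtNumber X) X :=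
  (Nat.sInf_mem (s := {k : ℕ | 1 ≤ k ∧ HasSchmidtDecomposition k X})
    ⟨max m 1, le_max_right _ _,
      (hasSchmidtDecomposition_of_posSemidef hX).mono (le_max_left _ _)⟩).2

theorem HasSchmidtDecomposition.isSeparable {m d : ℕ} {X : BiMat m d}
    (h : HasSchmidtDecomposition 1 X) : IsSeparable X := by
  obtain ⟨l, ψ, hψ, rfl⟩ := h
  have hprod : ∀ i, ∃ (u : Matrix (Fin m) (Fin 1) ℂ) (v : Matrix (Fin 1) (Fin d) ℂ),
      coeffMatrix (ψ i) = u * v := fun i =>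
    exists_rank_factorization _ ((schmidtRank_eq_rank (ψ i)).symm.trans_le (hψ i))
  choose u v huv using hprod
  refine ⟨l, fun i => vecMulVec (fun a => u i a 0) (star fun a => u i a 0),
    fun i => vecMulVec (v i 0) (star (v i 0)), fun i => posSemidef_vecMulVec_self_star _,
    fun i => posSemidef_vecMulVec_self_star _, Finset.sum_congr rfl fun i _ => ?_⟩
  have hψi : ∀ p, ψ i p = u i p.1 0 * v i 0 p.2 := fun p => by
    have := congrFun (congrFun (huv i) p.1) p.2
    simpa [coeffMatrix, Matrix.mul_apply] using this
  ext p q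
  simp only [proj, vecMulVec_apply, Pi.star_apply, hψi, kroneckerMap_apply, star_mul']
  ring

/-- A separable matrix is `A * Aᴴ` with product vectors as the columns of `A`. -/
theorem IsSeparable.exists_product_columns {m d : ℕ} {X : BiMat m d} (h : IsSeparable X) :
    ∃ (γ : Type) (_ : Fintype γ) (u : γ → Fin m → ℂ) (v : γ → Fin d → ℂ),
      X = (Matrix.of fun p j => u j p.1 * v j p.2) *
        (Matrix.of fun (p : Fin m × Fin d) j => u j p.1 * v j p.2)ᴴ := by
  obtain ⟨l, A, B, hA, hB, rfl⟩ := h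
  choose r C hC using fun i => exists_eq_mul_conjTranspose_of_posSemidef (hA i)
  choose s D hD using fun i => exists_eq_mul_conjTranspose_of_posSemidef (hB i)
  refine ⟨Σ i, Fin (r i) × Fin (s i), inferInstance, fun j a => C j.1 a j.2.1,
    fun j a => D j.1 a j.2.2, ?_⟩
  ext p q
  rw [Matrix.sum_apply, Matrix.mul_apply, Fintype.sum_sigma]
  refine Finset.sum_congr rfl fun i _ => ?_
  have hK : A i ⊗ₖ B i = (C i ⊗ₖ D i) * (C i ⊗ₖ D i)ᴴ := by
    rw [conjTranspose_kronecker, ← mul_kronecker_mul, ← hC, ← hD]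
  rw [hK]
  rfl

/-! ### Lowering the Schmidt number -/

/-- If the compression of a positive matrix on `ℂ^(n+m) ⊗ ℂ^d` to `ℂ^n ⊗ ℂ^d` is separable, then the
matrix decomposes into vectors of Schmidt rank at most `m + 1`. -/
theorem hasSchmidtDecomposition_of_compression_isSeparable {n m d : ℕ} {Y : BiMat (n + m) d}
    (hY : Y.PosSemidef)
    (hsep : IsSeparable (Y.submatrix (fun p : Fin n × Fin d => (Fin.castAdd m p.1, p.2))
      (fun p => (Fin.castAdd m p.1, p.2)))) :
    HasSchmidtDecomposition (m + 1) Y := by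
  classical
  obtain ⟨γ, _, u, v, hA⟩ := hsep.exists_product_columns
  let e : (Fin n × Fin d) ⊕ (Fin m × Fin d) ≃ Fin (n + m) × Fin d :=
    (Equiv.sumProdDistrib _ _ _).symm.trans (finSumFinEquiv.prodCongr (Equiv.refl _))
  obtain ⟨l, X, C, hG⟩ := exists_fromBlocks_factorization (hY.submatrix e)
    (Matrix.of fun (p : Fin n × Fin d) j => u j p.1 * v j p.2) hA
  set G := fromBlocks (Matrix.of fun (p : Fin n × Fin d) j => u j p.1 * v j p.2) 0 X C with hGdef
  -- The first `n` rows of the coefficient matrix of a column of `G` have rank at most one.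
  have hcol : ∀ j, ∃ (a : Fin n → ℂ) (b : Fin d → ℂ),
      ∀ p, G (Sum.inl p) j = a p.1 * b p.2 := by
    rintro (j | j)
    · exact ⟨u j, v j, fun p => rfl⟩
    · exact ⟨0, 0, fun p => by simp [hGdef]⟩
  refine .of_fintype (fun j p => G (e.symm p) j) (fun j => ?_) ?_
  · obtain ⟨a, b, hab⟩ := hcol j
    rw [schmidtRank_eq_rank]
    have hdecomp : coeffMatrix (fun p => G (e.symm p) j) =
        (Matrix.of fun (i : Fin (n + m)) (s : Fin m) => if i = Fin.natAdd n s then (1 : ℂ) else 0) *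
          (Matrix.of fun s c => G (Sum.inr (s, c)) j) + vecMulVec (Fin.append a 0) b := by
      ext i c
      induction i using Fin.addCases with
      | left i =>
        have he : e.symm (Fin.castAdd m i, c) = Sum.inl (i, c) := by
          rw [Equiv.symm_apply_eq]; rfl
        have hne : ∀ s : Fin m, Fin.castAdd m i ≠ Fin.natAdd n s := fun s hs => by
          have := congrArg Fin.val hs
          simp at this
          omega
        simp [coeffMatrix, he, hab, Matrix.mul_apply, vecMulVec_apply, hne]
      | right i =>
        have he : e.symm (Fin.natAdd n i, c) = Sum.inr (i, c) := by
          rw [Equiv.symm_apply_eq]; rfl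
        simp [coeffMatrix, he, Matrix.mul_apply, vecMulVec_apply]
    rw [hdecomp]
    exact (rank_add_le _ _).trans (Nat.add_le_add ((rank_mul_le_left _ _).trans
      (rank_le_width _)) (rank_vecMulVec_le _ _))
  · ext p q
    have := congrFun (congrFun hG (e.symm p)) (e.symm q)
    simp only [submatrix_apply, Equiv.apply_symm_apply] at this
    rw [this, Matrix.sum_apply]
    rfl

/-- An `n`-entanglement breaking map lowers Schmidt rank bounds from `n + m` to `m + 1`: every vector
in a decomposition comes from `ℂ^(n+m) ⊗ ℂ^d₁`, where the compression criterion applies. -/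
theorem HasSchmidtDecomposition.idTensor {n m p d₁ d₂ : ℕ} {T : Mat d₁ →ₗ[ℂ] Mat d₂}
    (hcp : IsCompletelyPositive T) (heb : IsNEntanglementBreaking n T) {X : BiMat p d₁}
    (h : HasSchmidtDecomposition (n + m) X) : HasSchmidtDecomposition (m + 1) (idTensor p T X) := by
  obtain ⟨l, ψ, hψ, rfl⟩ := h
  rw [map_sum]
  refine .sum fun i => ?_
  obtain ⟨U, V, hUV⟩ := exists_rank_factorization (coeffMatrix (ψ i))
    ((schmidtRank_eq_rank (ψ i)).symm.trans_le (hψ i))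
  have hproj : proj (ψ i) = SchmidtIteration.leftConj d₁ U (proj fun q => V q.1 q.2) := by
    rw [leftConj_proj]
    congr 1
    ext q
    exact congrFun (congrFun hUV q.1) q.2
  rw [hproj, idTensor_leftConj]
  have hpos : (proj fun q => V q.1 q.2 : BiMat (n + m) d₁).PosSemidef :=
    posSemidef_vecMulVec_self_star _
  exact (hasSchmidtDecomposition_of_compression_isSeparable (hcp _ _ hpos)
    (heb _ (hpos.submatrix fun q : Fin n × Fin d₁ => (Fin.castAdd m q.1, q.2)))).leftConj U

theorem schmidtNumber_idTensor_le {n p d₁ d₂ : ℕ} (hn : 1 ≤ n) {T : Mat d₁ →ₗ[ℂ] Mat d₂}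
    (hcp : IsCompletelyPositive T) (heb : IsNEntanglementBreaking n T) {X : BiMat p d₁}
    (hX : X.PosSemidef) :
    schmidtNumber (idTensor p T X) ≤ max (schmidtNumber X - (n - 1)) 1 := by
  have hdec : HasSchmidtDecomposition (n + (schmidtNumber X - n)) X :=
    (hasSchmidtDecomposition_schmidtNumber hX).mono (by omega)
  exact ((hdec.idTensor hcp heb).schmidtNumber_le (by omega)).trans (by omega)

/-! ### Composition -/

theorem idTensor_comp {m d : ℕ} (S T : Mat d →ₗ[ℂ] Mat d) (X : BiMat m d) :
    idTensor m (S ∘ₗ T) X = idTensor m S (idTensor m T X) := rfl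

/-- Positivity is part of the conclusion because the induction needs it at each step. -/
theorem schmidtNumber_idTensor_compose_le {p d n : ℕ} (hn : 1 ≤ n)
    (T : ℕ → (Mat d →ₗ[ℂ] Mat d)) (N : ℕ)
    (hT : ∀ i, 1 ≤ i → i ≤ N → IsCompletelyPositive (T i) ∧ IsNEntanglementBreaking n (T i))
    {X : BiMat p d} (hX : X.PosSemidef) :
    (idTensor p (compose T N) X).PosSemidef ∧
      schmidtNumber (idTensor p (compose T N) X) ≤ max (schmidtNumber X - N * (n - 1)) 1 := by
  induction N with
  | zero => exact ⟨hX, by simp [show idTensor p (compose T 0) X = X from rfl]⟩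
  | succ N ih =>
    obtain ⟨hpos, hle⟩ := ih fun i h1 h2 => hT i h1 (by omega)
    obtain ⟨hcp, heb⟩ := hT (N + 1) (by omega) le_rfl
    have hstep := schmidtNumber_idTensor_le hn hcp heb hpos
    rw [compose, idTensor_comp, Nat.succ_mul]
    exact ⟨hcp _ _ hpos, hstep.trans (by omega)⟩

theorem isEntanglementBreaking_compose {d n N : ℕ} (hn : 1 ≤ n) (hN : d ≤ N * (n - 1) + 1)
    (T : ℕ → (Mat d →ₗ[ℂ] Mat d))
    (hT : ∀ i, 1 ≤ i → i ≤ N → IsCompletelyPositive (T i) ∧ IsNEntanglementBreaking n (T i)) :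
    IsEntanglementBreaking (compose T N) := by
  intro X hX
  obtain ⟨hpos, hle⟩ := schmidtNumber_idTensor_compose_le hn T N hT hX
  -- `d = 0` is allowed, whereas a Schmidt number is at least one by definition.
  have hXd : schmidtNumber X ≤ max d 1 :=
    ((hasSchmidtDecomposition_of_posSemidef hX).mono (le_max_left _ _)).schmidtNumber_le
      (le_max_right _ _)
  exact ((hasSchmidtDecomposition_schmidtNumber hpos).mono (by omega)).isSeparable

end SchmidtIteration


/-- Schmidt number iteration: a completely positive `n`-entanglement breaking map lowers the
Schmidt number by `n - 1` (down to `1` at the least), and the composition of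
`⌈(d - 1) / (n - 1)⌉` such maps is entanglement breaking. -/
theorem mainTheorem2 (d n : ℕ) (hn : 2 ≤ n) :
    (∀ T : SchmidtIteration.Mat d →ₗ[ℂ] SchmidtIteration.Mat d,
      SchmidtIteration.IsCompletelyPositive T →
      SchmidtIteration.IsNEntanglementBreaking n T →
      ∀ X : SchmidtIteration.BiMat d d, X.PosSemidef →
        SchmidtIteration.schmidtNumber (SchmidtIteration.idTensor d T X) ≤
          max (SchmidtIteration.schmidtNumber X - (n - 1)) 1) ∧
    (∀ T : ℕ → (SchmidtIteration.Mat d →ₗ[ℂ] SchmidtIteration.Mat d),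
      (∀ i : ℕ, 1 ≤ i → i ≤ ⌈((d : ℚ) - 1) / ((n : ℚ) - 1)⌉₊ →
        SchmidtIteration.IsCompletelyPositive (T i) ∧
        SchmidtIteration.IsNEntanglementBreaking n (T i)) →
      SchmidtIteration.IsEntanglementBreaking
        (SchmidtIteration.compose T ⌈((d : ℚ) - 1) / ((n : ℚ) - 1)⌉₊)) := by
  refine ⟨fun T hcp heb X hX => SchmidtIteration.schmidtNumber_idTensor_le (by omega) hcp heb hX,
    fun T hT => SchmidtIteration.isEntanglementBreaking_compose (by omega) ?_ T hT⟩
  have hpos : (0 : ℚ) < (n : ℚ) - 1 := by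
    have : (2 : ℚ) ≤ n := by exact_mod_cast hn
    linarith
  have hceil := (div_le_iff₀ hpos).mp (Nat.le_ceil (((d : ℚ) - 1) / ((n : ℚ) - 1)))
  have hcast : ((n - 1 : ℕ) : ℚ) = (n : ℚ) - 1 := by
    push_cast [Nat.cast_sub (show 1 ≤ n by omega)]
    ring
  rw [← hcast] at hceil ⊢
  have : (d : ℚ) ≤ ((⌈((d : ℚ) - 1) / ((n - 1 : ℕ) : ℚ)⌉₊ * (n - 1) + 1 : ℕ) : ℚ) := by
    rw [Nat.cast_add, Nat.cast_mul, Nat.cast_one]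
    linarith
  exact_mod_cast this
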